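/- Let $q=2^r$ with $r\ge 1$, let $n\ge 1$ be an odd integer, and let $\operatorname{tr}(x)=x+x^2+\cdots+x^{2^{r-1}}$ be the absolute trace $\mathbb{F}_q\to\mathbb{F}_2$. Let $O(2n+1,q)$ be the group of all matrices in $GL(2n+1,q)$ that preserve the quadratic form $\theta(x)=\sum_{i=1}^n x_ix_{n+i}+x_{2n+1}^2$ on $\mathbb{F}_q^{2n+1}$. Let $$P=\left\{\begin{bmatrix}A&0&0\\0&{}^tA^{-1}&0\\0&0&1\end{bmatrix}\begin{bmatrix}1_n&B&0\\0&1_n&0\\0&h&1\end{bmatrix}\ :\ A\in GL(n,q),\ B\in\mathbb{F}_q^{n\times n},\ h\in\mathbb{F}_q^{1\times n},\ B+{}^th\,h\text{ alternating}\right\}\subset O(2n+1,q),$$ where an $n\times n$ matrix $(a_{ij})$ is alternating if $a_{ii}=0$ for all $i$ and $a_{ij}=-a_{ji}$ for all $i,j$. Let $\sigma_{n-1}\in O(2n+1,q)$ be the permutation matrix that exchanges the $i$-th and the $(n+i)$-th standard basis vectors for $1\le i\le n-1$ and fixes the other standard basis vectors. Put $DC(n,q)=P\sigma_{n-1}P$,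 and for $\beta\in\mathbb{F}_q$ let $n(\beta)$ be the number of $w\in DC(n,q)$ whose matrix trace is $\beta$. Put $$A(n,q)=q^{\frac14(5n^2-1)}\,\frac{q^n-1}{q-1}\prod_{j=1}^{(n-1)/2}(q^{2j-1}-1),\qquad B(n,q)=q^{\frac14(n-1)^2}(q^n-1)\prod_{j=1}^{(n-1)/2}(q^{2j}-1).$$ Then, for every $\beta\in\mathbb{F}_q$, $$n(\beta)=q^{-1}A(n,q)B(n,q)+q^{-1}A(n,q)\times\begin{cases}1,&\text{if }\beta=1,\\ q+1,&\text{if }\beta\ne1\text{ and }\operatorname{tr}((\beta-1)^{-1})=0,\\ -q+1,&\text{if }\beta\neq1\text{ and }\operatorname{tr}((\beta-1)^{-1})=1.\end{cases}$$ -/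

import Mathlib

open Matrix

namespace OrthDoubleCoset

/-- Indices of the `2n+1` coordinates, in the order `e^1,…,e^n`, `e^{n+1},…,e^{2n}`, `e^{2n+1}`. -/
abbrev Idx (n : ℕ) : Type := (Fin n ⊕ Fin n) ⊕ Fin 1

section

variable {F : Type*} [Field F]

/-- The quadratic form `θ(x) = ∑_{i=1}^n x_i x_{n+i} + x_{2n+1}^2`. -/
def theta (n : ℕ) (x : Idx n → F) : F :=
  ∑ i : Fin n, x (Sum.inl (Sum.inl i)) * x (Sum.inl (Sum.inr i)) + x (Sum.inr 0) ^ 2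

variable (F) in
/-- The orthogonal group `O(2n+1, F)`: all isometries of `θ`. -/
def orthogonalGroup (n : ℕ) : Subgroup (GL (Idx n) F) where
  carrier := {w | ∀ x : Idx n → F, theta n ((w : Matrix (Idx n) (Idx n) F) *ᵥ x) = theta n x}
  one_mem' := by intro x; simp
  mul_mem' := by
    intro a b ha hb x
    rw [Units.val_mul, ← mulVec_mulVec, ha, hb]
  inv_mem' := by
    intro a ha x
    rw [← ha, mulVec_mulVec, ← Units.val_mul, mul_inv_cancel, Units.val_one, one_mulVec]

/-- A square matrix is alternating if its diagonal vanishes and `a_{ij} = -a_{ji}`. -/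
def IsAlternating {n : ℕ} (M : Matrix (Fin n) (Fin n) F) : Prop :=
  (∀ i, M i i = 0) ∧ ∀ i j, M i j = - M j i

variable (F) in
/-- The maximal parabolic subgroup `P(2n+1, F)` of `O(2n+1, F)`, as a set: all products
`diag(A, ᵗA⁻¹, 1) * [[1, B, 0], [0, 1, 0], [0, h, 1]]` with `A` invertible and
`B + ᵗh h` alternating. -/
def parabolic (n : ℕ) : Set (orthogonalGroup F n) :=
  {w | ∃ (A : GL (Fin n) F) (B : Matrix (Fin n) (Fin n) F) (h : Matrix (Fin 1) (Fin n) F),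
    IsAlternating (B + hᵀ * h) ∧
    ((w : GL (Idx n) F) : Matrix (Idx n) (Idx n) F) =
      fromBlocks
          (fromBlocks (A : Matrix (Fin n) (Fin n) F) 0 0 ((A⁻¹ : GL (Fin n) F) : Matrix (Fin n) (Fin n) F)ᵀ)
          0 0 1 *
        fromBlocks (fromBlocks 1 B 0 1) 0 (fromCols 0 h) 1}

/-- The diagonal `n × n` matrix `diag(1_r, 0_{n-r})`. -/
def headOne (F : Type*) [Field F] (n r : ℕ) : Matrix (Fin n) (Fin n) F :=
  diagonal fun i => if (i : ℕ) < r then 1 else 0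

/-- The diagonal `n × n` matrix `diag(0_r, 1_{n-r})`. -/
def tailOne (F : Type*) [Field F] (n r : ℕ) : Matrix (Fin n) (Fin n) F :=
  diagonal fun i => if (i : ℕ) < r then 0 else 1

/-- The matrix `σ_r`, exchanging `e^i` and `e^{n+i}` for `i ≤ r` and fixing the other `e^i`. -/
def sigmaMatrix (F : Type*) [Field F] (n r : ℕ) : Matrix (Idx n) (Idx n) F :=
  fromBlocks (fromBlocks (tailOne F n r) (headOne F n r) (headOne F n r) (tailOne F n r)) 0 0 1

theorem sigmaMatrix_mul_self (n r : ℕ) : sigmaMatrix F n r * sigmaMatrix F n r = 1 := by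
  have h1 : tailOne F n r * tailOne F n r + headOne F n r * headOne F n r = 1 := by
    simp only [tailOne, headOne, diagonal_mul_diagonal, diagonal_add, ← diagonal_one]
    congr 1; funext i; split_ifs <;> simp
  have h2 : tailOne F n r * headOne F n r + headOne F n r * tailOne F n r = 0 := by
    simp only [tailOne, headOne, diagonal_mul_diagonal, diagonal_add, ← diagonal_zero]
    congr 1; funext i; split_ifs <;> simp
  simp only [sigmaMatrix, fromBlocks_multiply, Matrix.mul_zero, Matrix.zero_mul, add_zero,
    zero_add, Matrix.mul_one, h1, h2, add_comm (headOne F n r * headOne F n r), add_comm (headOne F n r * tailOne F n r),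
    fromBlocks_one]

/-- `σ_r` as an element of the orthogonal group. -/
def sigma (F : Type*) [Field F] (n r : ℕ) : orthogonalGroup F n :=
  ⟨⟨sigmaMatrix F n r, sigmaMatrix F n r, sigmaMatrix_mul_self n r, sigmaMatrix_mul_self n r⟩, by
    intro x
    simp only [theta, sigmaMatrix]
    congr 1
    · refine Finset.sum_congr rfl fun i _ => ?_
      simp only [mulVec, dotProduct, Fintype.sum_sum_type, fromBlocks_apply₁₁, fromBlocks_apply₁₂,
        fromBlocks_apply₂₁, fromBlocks_apply₂₂, tailOne, headOne, diagonal_apply, Matrix.zero_apply]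
      by_cases hi : (i : ℕ) < r <;> simp [hi, mul_comm]
    · simp [mulVec, dotProduct, Fintype.sum_sum_type]⟩

variable (F) in
/-- The double coset `DC(n, q) = P(2n+1, q) σ_{n-1} P(2n+1, q)`. -/
def DC (n : ℕ) : Set (orthogonalGroup F n) :=
  DoubleCoset.doubleCoset (sigma F n (n - 1)) (parabolic F n) (parabolic F n)

/-- The number `n(β)` of elements of `DC(n, q)` whose matrix trace is `β`. -/
noncomputable def traceCount (n : ℕ) (β : F) : ℕ :=
  {w : orthogonalGroup F n | w ∈ DC F n ∧
    trace ((w : GL (Idx n) F) : Matrix (Idx n) (Idx n) F) = β}.ncard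

/-- The absolute trace `tr(x) = x + x^2 + ⋯ + x^{2^{r-1}}` of a field with `2^r` elements. Its
values lie in the prime field `{0, 1}`. -/
def absTrace (r : ℕ) (x : F) : F := ∑ i ∈ Finset.range r, x ^ (2 ^ i)

end

/-- The `q`-binomial coefficient `∏_{j=0}^{r-1} (q^{n-j} - 1) / (q^{r-j} - 1)`. -/
def qBinom (n r q : ℕ) : ℚ :=
  ∏ j ∈ Finset.range r, ((q : ℚ) ^ (n - j) - 1) / ((q : ℚ) ^ (r - j) - 1)

/-- `A(n, q)`, for odd `n` (all the divisions of exponents are then exact). -/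
def coeffA (n q : ℕ) : ℚ :=
  (q : ℚ) ^ ((5 * n ^ 2 - 1) / 4) * qBinom n 1 q *
    ∏ j ∈ Finset.Icc 1 ((n - 1) / 2), ((q : ℚ) ^ (2 * j - 1) - 1)

/-- `B(n, q)`, for odd `n` (all the divisions of exponents are then exact). -/
def coeffB (n q : ℕ) : ℚ :=
  (q : ℚ) ^ ((n - 1) ^ 2 / 4) * ((q : ℚ) ^ n - 1) *
    ∏ j ∈ Finset.Icc 1 ((n - 1) / 2), ((q : ℚ) ^ (2 * j) - 1)

end OrthDoubleCoset

namespace OrthDoubleCoset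

section Alternating

variable {F : Type*} [Field F] {ι κ : Type*}

/-- Alternating matrices over an arbitrary index type. -/
def IsAlt (M : Matrix ι ι F) : Prop := (∀ i, M i i = 0) ∧ ∀ i j, M i j = -M j i

theorem IsAlt.dotProduct_mulVec_self [Fintype ι] {M : Matrix ι ι F} (hM : IsAlt M) (x : ι → F) :
    x ⬝ᵥ M *ᵥ x = 0 := by
  classical
  simp only [dotProduct, mulVec, Finset.mul_sum]
  rw [← Finset.sum_product']
  refine Finset.sum_involution (fun p _ => (p.2, p.1)) ?_ ?_ (by simp) (by simp)
  · rintro ⟨i, j⟩ -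
    rw [hM.2 i j]; ring
  · rintro ⟨i, j⟩ - h h'
    obtain rfl : j = i := congrArg Prod.fst h'
    exact h (by simp [hM.1])

theorem isAlt_iff_dotProduct_mulVec_self [Fintype ι] {M : Matrix ι ι F} :
    IsAlt M ↔ ∀ x : ι → F, x ⬝ᵥ M *ᵥ x = 0 := by
  classical
  refine ⟨fun hM => hM.dotProduct_mulVec_self, fun h => ?_⟩
  have hd : ∀ i, M i i = 0 := fun i => by simpa using h (Pi.single i 1)
  refine ⟨hd, fun i j => ?_⟩
  have := h (Pi.single i 1 + Pi.single j 1)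
  simp [mulVec_add, hd] at this
  rw [eq_neg_iff_add_eq_zero, add_comm]
  simpa [add_comm] using this

theorem IsAlt.conj [Fintype ι] {M : Matrix ι ι F} (hM : IsAlt M) (g : Matrix κ ι F)
    [Fintype κ] : IsAlt (g * M * gᵀ) := by
  rw [isAlt_iff_dotProduct_mulVec_self]
  intro x
  rw [← mulVec_mulVec, ← mulVec_mulVec, dotProduct_mulVec, ← mulVec_transpose]
  exact hM.dotProduct_mulVec_self _

theorem exists_GL_mulVec_eq [Fintype κ] [DecidableEq κ] {v w : κ → F} (hv : v ≠ 0) (hw : w ≠ 0) :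
    ∃ g : GL κ F, (g : Matrix κ κ F) *ᵥ v = w := by
  obtain ⟨g, hg⟩ := Submodule.exists_linearEquiv_restrict_eq
    ((LinearEquiv.toSpanNonzeroSingleton F _ v hv).symm.trans
      (LinearEquiv.toSpanNonzeroSingleton F _ w hw))
  refine ⟨⟨LinearMap.toMatrix' g.toLinearMap, LinearMap.toMatrix' g.symm.toLinearMap, ?_, ?_⟩, ?_⟩
  · rw [← LinearMap.toMatrix'_comp]; simp
  · rw [← LinearMap.toMatrix'_comp]; simp
  · have h := hg ⟨v, Submodule.mem_span_singleton_self v⟩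
    have h1 : (LinearEquiv.toSpanNonzeroSingleton F _ v hv).symm
        ⟨v, Submodule.mem_span_singleton_self v⟩ = 1 := by
      rw [LinearEquiv.symm_apply_eq]; ext; simp
    simp [LinearMap.toMatrix'_mulVec] at *
    rw [← h, h1]; simp

variable (F) in
/-- The number of invertible alternating matrices. -/
noncomputable def altCount (ι : Type*) [Fintype ι] [DecidableEq ι] : ℕ :=
  Nat.card {M : Matrix ι ι F // IsAlt M ∧ M.det ≠ 0}

theorem altCount_congr [Fintype ι] [DecidableEq ι] [Fintype κ] [DecidableEq κ] (e : ι ≃ κ) :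
    altCount F ι = altCount F κ := by
  refine Nat.card_congr ((Matrix.reindex e e).subtypeEquiv fun M => ?_)
  rw [det_reindex_self]
  refine and_congr_left fun _ => ?_
  simp only [IsAlt, reindex_apply, submatrix_apply, e.symm.forall_congr_left, Equiv.symm_symm, Equiv.symm_apply_apply]

/-- The alternating matrix with first row `(0, v)` and lower right block `D`. -/
def border (v : κ → F) (D : Matrix κ κ F) : Matrix (Unit ⊕ κ) (Unit ⊕ κ) F :=
  fromBlocks 0 (replicateRow Unit v) (-replicateCol Unit v) D

theorem isAlt_border {v : κ → F} {D : Matrix κ κ F} : IsAlt (border v D) ↔ IsAlt D := by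
  simp [IsAlt, border, Sum.forall]

/-- Alternating matrices of size `1 + κ` are bordered alternating matrices of size `κ`. -/
def altBorderEquiv (p : Matrix (Unit ⊕ κ) (Unit ⊕ κ) F → Prop) :
    {M : Matrix (Unit ⊕ κ) (Unit ⊕ κ) F // IsAlt M ∧ p M} ≃
      Σ v : κ → F, {D : Matrix κ κ F // IsAlt D ∧ p (border v D)} where
  toFun M := ⟨fun j => M.1 (Sum.inl ()) (Sum.inr j), M.1.toBlocks₂₂, by
    have : border (fun j => M.1 (Sum.inl ()) (Sum.inr j)) M.1.toBlocks₂₂ = M.1 := by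
      ext (_ | i) (_ | j)
      · simp [border, M.2.1.1]
      · simp [border]
      · simp [border, M.2.1.2 (Sum.inr i)]
      · simp [border, toBlocks₂₂]
    rw [this, ← isAlt_border (v := fun j => M.1 (Sum.inl ()) (Sum.inr j)), this]
    exact M.2⟩
  invFun x := ⟨border x.1 x.2.1, isAlt_border.2 x.2.2.1, x.2.2.2⟩
  left_inv M := by
    ext (_ | i) (_ | j)
    · simp [border, M.2.1.1]
    · simp [border]
    · simp [border, M.2.1.2 (Sum.inr i)]
    · simp [border, toBlocks₂₂]
  right_inv x := by
    rcases x with ⟨v, D, hD⟩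
    simp [border]

variable [Fintype κ] [DecidableEq κ]

theorem det_border_zero (D : Matrix κ κ F) : (border 0 D).det = 0 :=
  det_eq_zero_of_row_eq_zero (Sum.inl ()) (by simp [border, Sum.forall])

theorem det_border_conj (g : Matrix κ κ F) (v : κ → F) (D : Matrix κ κ F) :
    (border (g *ᵥ v) (g * D * gᵀ)).det = g.det ^ 2 * (border v D).det := by
  have h : border (g *ᵥ v) (g * D * gᵀ) =
      fromBlocks 1 0 0 g * border v D * (fromBlocks 1 0 0 g)ᵀ := by
    simp only [border, fromBlocks_transpose, fromBlocks_multiply]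
    ext (_ | i) (_ | j) <;> simp [mulVec, dotProduct, Matrix.mul_apply, mul_comm]
  rw [h, det_mul, det_mul, det_transpose, det_fromBlocks_zero₁₂]
  simp; ring

theorem det_border_border (u : κ → F) (D : Matrix κ κ F) :
    (border (Sum.elim 1 0) (border u D)).det = D.det := by
  rw [← det_reindex_self (Equiv.sumAssoc Unit Unit κ).symm]
  have h : reindex (Equiv.sumAssoc Unit Unit κ).symm (Equiv.sumAssoc Unit Unit κ).symm
      (border (Sum.elim 1 0) (border u D)) =
      fromBlocks (fromBlocks 0 1 (-1) 0) (fromRows 0 (replicateRow Unit u))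
        (fromCols 0 (-replicateCol Unit u)) D := by
    ext ((_ | _) | i) ((_ | _) | j) <;> simp [border]
  let J : Matrix (Unit ⊕ Unit) (Unit ⊕ Unit) F := fromBlocks 0 1 (-1) 0
  let J' : Matrix (Unit ⊕ Unit) (Unit ⊕ Unit) F := fromBlocks 0 (-1) 1 0
  let _ : Invertible J := ⟨J', by simp [J, J', fromBlocks_multiply],
    by simp [J, J', fromBlocks_multiply]⟩
  have hJ : (⅟J) = J' := rfl
  have hd : J.det = 1 := by
    rw [← det_submatrix_equiv_self (finTwoEquiv.trans Equiv.boolEquivPUnitSumPUnit) J, det_fin_two]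
    simp [J, finTwoEquiv, Equiv.boolEquivPUnitSumPUnit]
  rw [h]
  change (fromBlocks J _ _ D).det = _
  rw [det_fromBlocks₁₁, hd, hJ, one_mul]
  congr 1
  simp [J', fromBlocks_mul_fromRows, fromCols_mul_fromRows, Matrix.mul_assoc]

theorem card_border_eq {v w : κ → F} (hv : v ≠ 0) (hw : w ≠ 0) :
    Nat.card {D : Matrix κ κ F // IsAlt D ∧ (border v D).det ≠ 0} =
      Nat.card {D : Matrix κ κ F // IsAlt D ∧ (border w D).det ≠ 0} := by
  obtain ⟨g, rfl⟩ := exists_GL_mulVec_eq hv hw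
  have h1 : ((g⁻¹ : GL κ F) : Matrix κ κ F) * g = 1 := by rw [← Units.val_mul]; simp
  have h2 : (g : Matrix κ κ F) * ((g⁻¹ : GL κ F) : Matrix κ κ F) = 1 := by
    rw [← Units.val_mul]; simp
  let e : Matrix κ κ F ≃ Matrix κ κ F :=
    { toFun := fun D => (g : Matrix κ κ F) * D * (g : Matrix κ κ F)ᵀ
      invFun := fun D => ((g⁻¹ : GL κ F) : Matrix κ κ F) * D * ((g⁻¹ : GL κ F) : Matrix κ κ F)ᵀ
      left_inv := fun D => by
        simp only [Matrix.mul_assoc, ← transpose_mul]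
        rw [h1, ← Matrix.mul_assoc, h1]; simp
      right_inv := fun D => by
        simp only [Matrix.mul_assoc, ← transpose_mul]
        rw [h2, ← Matrix.mul_assoc, h2]; simp }
  refine Nat.card_congr (e.subtypeEquiv fun D => ?_)
  have hdet : (g : Matrix κ κ F).det ≠ 0 := by
    intro h
    have := congrArg Matrix.det h1
    rw [det_mul, h, det_one, mul_zero] at this
    exact zero_ne_one this
  refine and_congr ⟨fun h => h.conj _, fun h => ?_⟩ ?_
  · have := h.conj ((g⁻¹ : GL κ F) : Matrix κ κ F)
    rwa [show _ * e D * _ = D from e.left_inv D] at this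
  · change _ ↔ (border _ ((g : Matrix κ κ F) * D * (g : Matrix κ κ F)ᵀ)).det ≠ 0
    rw [det_border_conj]
    simp [hdet]

variable [Fintype F]

theorem altCount_unit_sum_unit_sum :
    altCount F (Unit ⊕ (Unit ⊕ κ)) =
      (Fintype.card F ^ (Fintype.card κ + 1) - 1) * (Fintype.card F ^ Fintype.card κ *
        altCount F κ) := by
  classical
  have hne : (Sum.elim 1 0 : Unit ⊕ κ → F) ≠ 0 := fun h => by
    simpa using congrFun h (Sum.inl ())
  have h1 : Nat.card {D : Matrix (Unit ⊕ κ) (Unit ⊕ κ) F //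
      IsAlt D ∧ (border (Sum.elim 1 0) D).det ≠ 0} =
        Fintype.card F ^ Fintype.card κ * altCount F κ := by
    rw [Nat.card_congr (altBorderEquiv fun M => (border (Sum.elim 1 0) M).det ≠ 0)]
    simp only [det_border_border]
    rw [Nat.card_sigma]
    simp [altCount]
  rw [altCount, Nat.card_congr (altBorderEquiv _), Nat.card_sigma,
    ← Finset.add_sum_erase _ _ (Finset.mem_univ 0)]
  rw [Finset.sum_congr rfl fun v hv => (card_border_eq (Finset.ne_of_mem_erase hv) hne).trans h1]
  simp [det_border_zero, Finset.card_erase_of_mem, add_comm 1]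

theorem altCount_fin (k : ℕ) :
    (altCount F (Fin (2 * k)) : ℚ) = (Fintype.card F : ℚ) ^ (k * (k - 1)) *
      ∏ j ∈ Finset.Icc 1 k, ((Fintype.card F : ℚ) ^ (2 * j - 1) - 1) := by
  induction k with
  | zero =>
    have : IsEmpty (Fin (2 * 0)) := inferInstanceAs (IsEmpty (Fin 0))
    have h : Nat.card {M : Matrix (Fin (2 * 0)) (Fin (2 * 0)) F // IsAlt M ∧ M.det ≠ 0} = 1 := by
      rw [Nat.card_eq_one_iff_unique]
      refine ⟨⟨fun a b => Subtype.ext (Subsingleton.elim _ _)⟩, ⟨1, ⟨fun i => ?_, fun i => ?_⟩, by simp⟩⟩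
      · exact this.elim i
      · exact this.elim i
    rw [altCount, h]; simp
  | succ k ih =>
    have e : Fin (2 * (k + 1)) ≃ Unit ⊕ (Unit ⊕ Fin (2 * k)) :=
      Fintype.equivOfCardEq (by simp; ring)
    rw [altCount_congr e, altCount_unit_sum_unit_sum, Finset.prod_Icc_succ_top (by omega)]
    have hq : 1 ≤ Fintype.card F ^ (2 * k + 1) := Nat.one_le_pow _ _ Fintype.card_pos
    simp only [Fintype.card_fin]
    push_cast [hq]
    rw [ih, show 2 * (k + 1) - 1 = 2 * k + 1 by omega,
      show (k + 1) * k = 2 * k + k * (k - 1) by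
        rcases k with _ | k
        · rfl
        · simp only [Nat.add_sub_cancel]; ring, pow_add]
    ring

end Alternating

section Quadratic

variable {F : Type*} [Field F]

theorem absTrace_add [CharP F 2] (r : ℕ) (x y : F) :
    absTrace r (x + y) = absTrace r x + absTrace r y := by
  simp [absTrace, add_pow_char_pow, Finset.sum_add_distrib]

/-- The number of nonzero `a` with `a + a⁻¹ + 1 = β`. -/
noncomputable def invCount (β : F) : ℕ := Nat.card {a : F // a ≠ 0 ∧ a + a⁻¹ + 1 = β}

theorem invCount_one [CharP F 2] : invCount (1 : F) = 1 := by
  rw [invCount, Nat.card_eq_one_iff_unique]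
  have key : ∀ a : F, (a ≠ 0 ∧ a + a⁻¹ + 1 = 1) → a = 1 := by
    rintro a ⟨h0, h⟩
    have h1 : a + a⁻¹ = 0 := by simpa using h
    have h2 : a ^ 2 = 1 ^ 2 := by
      have h3 : a = a⁻¹ := CharTwo.add_eq_zero.1 h1
      field_simp at h3
      rw [h3, one_pow]
    exact CharTwo.sq_injective h2
  refine ⟨⟨fun a b => Subtype.ext ((key a a.2).trans (key b b.2).symm)⟩, ⟨1, one_ne_zero, ?_⟩⟩
  rw [inv_one, CharTwo.add_self_eq_zero, zero_add]

theorem add_inv_eq_iff [CharP F 2] {c : F} (hc : c ≠ 0) (y : F) :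
    (c * y ≠ 0 ∧ c * y + (c * y)⁻¹ + 1 = c + 1) ↔ y ^ 2 + y = (c⁻¹) ^ 2 := by
  constructor
  · rintro ⟨h0, h⟩
    have hy : y ≠ 0 := right_ne_zero_of_mul h0
    have h := add_right_cancel h
    rw [← CharTwo.sub_eq_add]
    field_simp at h ⊢
    linear_combination h - CharTwo.two_eq_zero (R := F)
  · intro h
    have hy : y ≠ 0 := by
      rintro rfl
      exact inv_ne_zero hc (pow_eq_zero_iff two_ne_zero |>.1 (by simpa using h.symm))
    refine ⟨mul_ne_zero hc hy, ?_⟩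
    have h2 : (2 : F) = 0 := CharTwo.two_eq_zero
    field_simp at h ⊢
    linear_combination h + (1 - c ^ 2 * y) * h2

variable [Fintype F]

theorem absTrace_sq_eq {r : ℕ} (hF : Fintype.card F = 2 ^ r) (x : F) :
    absTrace r (x ^ 2) = absTrace r x := by
  simp only [absTrace, ← pow_mul, ← pow_succ']
  have h1 := Finset.sum_range_succ (fun i => x ^ 2 ^ i) r
  have h2 := Finset.sum_range_succ' (fun i => x ^ 2 ^ i) r
  rw [h1, ← hF, FiniteField.pow_card, pow_zero, pow_one] at h2
  exact (add_right_cancel h2).symm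

theorem card_absTrace_eq_zero_le {r : ℕ} (hr : r ≠ 0) :
    Nat.card {x : F // absTrace r x = 0} ≤ 2 ^ (r - 1) := by
  classical
  obtain ⟨r, rfl⟩ := Nat.exists_eq_succ_of_ne_zero hr
  let p : Polynomial F := ∑ i ∈ Finset.range (r + 1), Polynomial.X ^ 2 ^ i
  have hdeg : p.natDegree ≤ 2 ^ r := Polynomial.natDegree_sum_le_of_forall_le _ _ fun i hi => by
    rw [Polynomial.natDegree_X_pow]
    exact Nat.pow_le_pow_right (by norm_num) (by simpa [Nat.lt_succ_iff] using hi)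
  have hp : p ≠ 0 := fun h => by
    have := congrArg (Polynomial.coeff · 1) h
    simp only [p, Polynomial.finsetSum_coeff, Polynomial.coeff_X_pow, Polynomial.coeff_zero] at this
    rw [Finset.sum_eq_single 0] at this
    · simp at this
    · intro i _ hi
      rw [if_neg]
      exact (Nat.one_lt_two_pow hi).ne
    · simp
  rw [Nat.card_eq_fintype_card, Fintype.card_subtype]
  refine (Finset.card_le_card (t := p.roots.toFinset) fun x hx => ?_).trans
    ((Multiset.toFinset_card_le _).trans ((Polynomial.card_roots' p).trans hdeg))
  have hx : absTrace (r + 1) x = 0 := (Finset.mem_filter.1 hx).2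
  simpa [p, hp, Polynomial.eval_finsetSum, absTrace] using hx

/-- The elements of absolute trace zero are those of the form `y ^ 2 + y`. -/
theorem exists_sq_add_self_iff {r : ℕ} [CharP F 2] (hF : Fintype.card F = 2 ^ r) (d : F) :
    (∃ y : F, y ^ 2 + y = d) ↔ absTrace r d = 0 := by
  have hr : r ≠ 0 := by
    rintro rfl
    exact Fintype.one_lt_card.ne' hF
  let f : F →+ F :=
    { toFun := fun y => y ^ 2 + y
      map_zero' := by simp
      map_add' := fun x y => by rw [CharTwo.add_sq]; ring }
  have hle : (f.range : Set F) ⊆ {x : F | absTrace r x = 0} := by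
    rintro _ ⟨y, rfl⟩
    change absTrace r (y ^ 2 + y) = 0
    rw [absTrace_add, absTrace_sq_eq hF, CharTwo.add_self_eq_zero]
  have hker : Nat.card f.ker ≤ 2 := by
    have : (f.ker : Set F) ⊆ ({0, 1} : Set F) := by
      intro y hy
      have hy : y ^ 2 + y = 0 := hy
      rcases mul_eq_zero.1 (show y * (y + 1) = 0 by rw [← hy]; ring) with h | h
      · simp [h]
      · right; exact CharTwo.add_eq_zero.1 h
    calc Nat.card f.ker = (f.ker : Set F).ncard := rfl
      _ ≤ ({0, 1} : Set F).ncard := Set.ncard_le_ncard this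
      _ = 2 := Set.ncard_pair zero_ne_one
  have hcard : Nat.card f.range * Nat.card f.ker = 2 ^ r := by
    rw [← hF, ← Nat.card_eq_fintype_card, ← AddSubgroup.card_mul_index f.ker, AddSubgroup.index_ker, mul_comm]
  have hge : 2 ^ (r - 1) ≤ Nat.card f.range := by
    obtain ⟨s, rfl⟩ := Nat.exists_eq_succ_of_ne_zero hr
    rw [pow_succ] at hcard
    simp only [Nat.succ_eq_add_one, Nat.add_sub_cancel]
    nlinarith
  have heq : (f.range : Set F) = {x : F | absTrace r x = 0} :=
    Set.eq_of_subset_of_ncard_le hle ((card_absTrace_eq_zero_le hr).trans hge)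
  exact Set.ext_iff.1 heq d

theorem invCount_of_absTrace [CharP F 2] {r : ℕ} (hF : Fintype.card F = 2 ^ r) {β : F}
    (hβ : β ≠ 1) : (absTrace r (β - 1)⁻¹ = 0 → invCount β = 2) ∧
      (absTrace r (β - 1)⁻¹ = 1 → invCount β = 0) := by
  obtain ⟨c, rfl⟩ : ∃ c, β = c + 1 := ⟨β - 1, by ring⟩
  have hc : c ≠ 0 := fun h => hβ (by simp [h])
  rw [add_sub_cancel_right, ← absTrace_sq_eq hF]
  have hcard : invCount (c + 1) = {y : F | y ^ 2 + y = (c⁻¹) ^ 2}.ncard :=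
    (Nat.card_congr ((Equiv.mulLeft₀ c hc).subtypeEquiv fun y => (add_inv_eq_iff hc y).symm)).symm
  rw [hcard]
  constructor
  · intro h
    obtain ⟨y, hy⟩ := (exists_sq_add_self_iff hF _).2 h
    have : {y : F | y ^ 2 + y = (c⁻¹) ^ 2} = {y, y + 1} := by
      ext z
      simp only [Set.mem_ofPred_eq, Set.mem_insert_iff, Set.mem_singleton_iff]
      rw [← hy]
      have h2 : (2 : F) = 0 := CharTwo.two_eq_zero
      constructor
      · intro hz
        have : (z - y) * (z - (y + 1)) = 0 := by
          linear_combination hz - (z * y - y ^ 2 + z - y) * h2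
        rcases mul_eq_zero.1 this with h | h
        · left; exact sub_eq_zero.1 h
        · right; exact sub_eq_zero.1 h
      · rintro (rfl | rfl)
        · rfl
        · linear_combination (y + 1) * h2
    rw [this, Set.ncard_pair (by simp)]
  · intro h
    rw [Set.ncard_eq_zero, Set.eq_empty_iff_forall_notMem]
    intro y hy
    have := (exists_sq_add_self_iff hF _).1 ⟨y, hy⟩
    rw [h] at this
    exact one_ne_zero this

end Quadratic

section Group

variable {G T : Type*} [Group G]

/-- The pairs `(x, y)` with `x * s * y = a * s * b` correspond to `P ∩ s * P * s⁻¹`. -/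
def doubleCosetFiberEquiv (P : Subgroup G) (s : G) (a b : P) :
    {x : P × P // (x.1 * s * x.2 : G) = a * s * b} ≃ {p : P // s⁻¹ * (p : G) * s ∈ P} where
  toFun x := ⟨a⁻¹ * x.1.1, by
    have h : s⁻¹ * ((a⁻¹ * x.1.1 : P) : G) * s = (b : G) * (x.1.2 : G)⁻¹ := by
      rw [eq_mul_inv_iff_mul_eq]
      calc s⁻¹ * ((a⁻¹ * x.1.1 : P) : G) * s * x.1.2
          = s⁻¹ * ((a : G)⁻¹ * (x.1.1 * s * x.1.2)) := by simp [mul_assoc]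
        _ = b := by rw [x.2]; group
    rw [h]
    exact P.mul_mem b.2 (P.inv_mem x.1.2.2)⟩
  invFun p := ⟨(a * p.1, ⟨_, P.inv_mem p.2⟩ * b), by
    simp only [Subgroup.coe_mul]
    group⟩
  left_inv x := by
    have h : (x.1.2 : G) = (s⁻¹ * ((a : G)⁻¹ * x.1.1) * s)⁻¹ * b := by
      rw [eq_inv_mul_iff_mul_eq]
      calc s⁻¹ * ((a : G)⁻¹ * x.1.1) * s * x.1.2
          = s⁻¹ * ((a : G)⁻¹ * (x.1.1 * s * x.1.2)) := by simp [mul_assoc]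
        _ = b := by rw [x.2]; group
    ext
    · simp
    · simp [h]
  right_inv p := by ext; simp

theorem card_inter_mul_ncard_doubleCoset [Finite G] (P : Subgroup G) (s : G) (f : G → T)
    (hf : ∀ a b, f (a * b) = f (b * a)) (t : T) :
    Nat.card {p : P // s⁻¹ * (p : G) * s ∈ P} *
        {w : G | w ∈ DoubleCoset.doubleCoset s (P : Set G) P ∧ f w = t}.ncard =
      Nat.card P * Nat.card {p : P // f (p * s) = t} := by
  classical
  have := Fintype.ofFinite G
  let X := {x : P × P // f (x.1 * s * x.2) = t}
  let W := {w : G | w ∈ DoubleCoset.doubleCoset s (P : Set G) P ∧ f w = t}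
  have h1 : Nat.card X = Nat.card P * Nat.card {p : P // f (p * s) = t} := by
    rw [← Nat.card_prod]
    refine Nat.card_congr
      { toFun := fun x => (x.1.2, ⟨x.1.2 * x.1.1, by
          have h := (hf (x.1.2 : G) (x.1.1 * s)).trans x.2
          simpa [mul_assoc] using h⟩)
        invFun := fun y => ⟨(y.1⁻¹ * y.2.1, y.1), by
          have h := hf ((y.1 : G)⁻¹ * (y.2.1 : P) * s) y.1
          have h' := y.2.2
          simp only [mul_assoc, mul_inv_cancel_left] at h h'
          simpa [mul_assoc, h'] using h⟩
        left_inv := fun x => by ext <;> simp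
        right_inv := fun y => by ext <;> simp }
  let φ : X → W := fun x => ⟨x.1.1 * s * x.1.2,
    DoubleCoset.mem_doubleCoset.2 ⟨_, x.1.1.2, _, x.1.2.2, rfl⟩, x.2⟩
  have h2 : ∀ w : W, Nat.card {x : X // φ x = w} = Nat.card {p : P // s⁻¹ * (p : G) * s ∈ P} := by
    rintro ⟨w, hw, hwt⟩
    obtain ⟨a, ha, b, hb, rfl⟩ := DoubleCoset.mem_doubleCoset.1 hw
    rw [← Nat.card_congr (doubleCosetFiberEquiv P s ⟨a, ha⟩ ⟨b, hb⟩)]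
    refine Nat.card_congr
      { toFun := fun x => ⟨x.1.1, congrArg Subtype.val x.2⟩
        invFun := fun x => ⟨⟨x.1, by rw [x.2]; exact hwt⟩, Subtype.ext x.2⟩
        left_inv := fun x => rfl
        right_inv := fun x => rfl }
  rw [← h1, ← Nat.card_congr (Equiv.sigmaFiberEquiv φ), Nat.card_sigma,
    Finset.sum_congr rfl fun w _ => h2 w, Finset.sum_const, smul_eq_mul, mul_comm,
    Finset.card_univ, ← Nat.card_eq_fintype_card]
  rfl

end Group

section Parabolic

variable {F : Type*} [Field F] {n : ℕ}

theorem theta_elim (u v : Fin n → F) (t : Fin 1 → F) :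
    theta n (Sum.elim (Sum.elim u v) t) = u ⬝ᵥ v + t 0 ^ 2 := rfl

theorem exists_eq_elim {α : Type*} (x : Idx n → α) :
    ∃ u v t, x = Sum.elim (Sum.elim u v) t :=
  ⟨fun i => x (Sum.inl (Sum.inl i)), fun i => x (Sum.inl (Sum.inr i)), fun i => x (Sum.inr i), by
    ext ((_ | _) | _) <;> rfl⟩

/-- The general element of the parabolic subgroup. -/
def paraMatrix (A : GL (Fin n) F) (B : Matrix (Fin n) (Fin n) F) (h : Matrix (Fin 1) (Fin n) F) :
    Matrix (Idx n) (Idx n) F :=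
  fromBlocks (fromBlocks (A : Matrix (Fin n) (Fin n) F) ((A : Matrix (Fin n) (Fin n) F) * B) 0
    ((A⁻¹ : GL (Fin n) F) : Matrix (Fin n) (Fin n) F)ᵀ) 0 (fromCols 0 h) 1

theorem paraMatrix_eq_mul (A : GL (Fin n) F) (B : Matrix (Fin n) (Fin n) F)
    (h : Matrix (Fin 1) (Fin n) F) :
    paraMatrix A B h = fromBlocks
          (fromBlocks (A : Matrix (Fin n) (Fin n) F) 0 0 ((A⁻¹ : GL (Fin n) F) : Matrix (Fin n) (Fin n) F)ᵀ)
          0 0 1 *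
        fromBlocks (fromBlocks 1 B 0 1) 0 (fromCols 0 h) 1 := by
  simp [paraMatrix, fromBlocks_multiply]

theorem GL_inv_mul (A : GL (Fin n) F) :
    ((A⁻¹ : GL (Fin n) F) : Matrix (Fin n) (Fin n) F) * (A : Matrix (Fin n) (Fin n) F) = 1 := by
  rw [← Units.val_mul, inv_mul_cancel, Units.val_one]

theorem GL_mul_inv (A : GL (Fin n) F) :
    (A : Matrix (Fin n) (Fin n) F) * ((A⁻¹ : GL (Fin n) F) : Matrix (Fin n) (Fin n) F) = 1 := by
  rw [← Units.val_mul, mul_inv_cancel, Units.val_one]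

theorem det_paraMatrix (A : GL (Fin n) F) (B : Matrix (Fin n) (Fin n) F)
    (h : Matrix (Fin 1) (Fin n) F) : (paraMatrix A B h).det = 1 := by
  rw [paraMatrix, det_fromBlocks_zero₁₂, det_fromBlocks_zero₂₁, det_transpose, ← det_mul,
    GL_mul_inv]
  simp

theorem dotProduct_mulVec_transpose_mul_self (h : Matrix (Fin 1) (Fin n) F) (v : Fin n → F) :
    v ⬝ᵥ (hᵀ * h) *ᵥ v = (h *ᵥ v) 0 ^ 2 := by
  rw [← mulVec_mulVec, dotProduct_mulVec, vecMul_transpose]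
  simp [dotProduct, sq]

theorem mem_parabolic_iff_exists {w : orthogonalGroup F n} :
    w ∈ parabolic F n ↔ ∃ (A : GL (Fin n) F) (B : Matrix (Fin n) (Fin n) F)
      (h : Matrix (Fin 1) (Fin n) F), IsAlternating (B + hᵀ * h) ∧
        ((w : GL (Idx n) F) : Matrix (Idx n) (Idx n) F) = paraMatrix A B h := by
  simp only [parabolic, paraMatrix_eq_mul]
  rfl

variable [CharP F 2]

theorem theta_paraMatrix (A : GL (Fin n) F) {B : Matrix (Fin n) (Fin n) F}
    {h : Matrix (Fin 1) (Fin n) F} (hB : IsAlternating (B + hᵀ * h)) (x : Idx n → F) :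
    theta n (paraMatrix A B h *ᵥ x) = theta n x := by
  obtain ⟨u, v, t, rfl⟩ := exists_eq_elim x
  have h0 := IsAlt.dotProduct_mulVec_self (M := B + hᵀ * h) hB v
  rw [add_mulVec, dotProduct_add, dotProduct_mulVec_transpose_mul_self, dotProduct_comm] at h0
  have key : ∀ y : Fin n → F, ((A : Matrix (Fin n) (Fin n) F) *ᵥ y) ⬝ᵥ
      (((A⁻¹ : GL (Fin n) F) : Matrix (Fin n) (Fin n) F)ᵀ *ᵥ v) = y ⬝ᵥ v := fun y => by
    rw [mulVec_transpose, dotProduct_comm, ← dotProduct_mulVec, mulVec_mulVec, GL_inv_mul,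
      one_mulVec, dotProduct_comm]
  have hx : paraMatrix A B h *ᵥ Sum.elim (Sum.elim u v) t =
      Sum.elim (Sum.elim ((A : Matrix (Fin n) (Fin n) F) *ᵥ (u + B *ᵥ v))
        (((A⁻¹ : GL (Fin n) F) : Matrix (Fin n) (Fin n) F)ᵀ *ᵥ v)) (h *ᵥ v + t) := by
    simp [paraMatrix, fromBlocks_mulVec, fromCols_mulVec, mulVec_add, Function.comp_def]
  rw [hx, theta_elim, theta_elim, key, add_dotProduct, Pi.add_apply, CharTwo.add_sq]
  linear_combination h0

/-- The element of the orthogonal group with matrix `paraMatrix A B h`. -/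
noncomputable def para (A : GL (Fin n) F) {B : Matrix (Fin n) (Fin n) F}
    {h : Matrix (Fin 1) (Fin n) F} (hB : IsAlternating (B + hᵀ * h)) : orthogonalGroup F n :=
  ⟨GeneralLinearGroup.mkOfDetNeZero (paraMatrix A B h) (by rw [det_paraMatrix]; exact one_ne_zero),
    theta_paraMatrix A hB⟩

theorem eq_paraMatrix_of_isometry {A X D : Matrix (Fin n) (Fin n) F} {x y : Matrix (Fin n) (Fin 1) F}
    {h : Matrix (Fin 1) (Fin n) F} {c : Matrix (Fin 1) (Fin 1) F}
    (hw : ∀ z, theta n (fromBlocks (fromBlocks A X 0 D) (fromRows x y) (fromCols 0 h) c *ᵥ z) =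
      theta n z) :
    ∃ (A' : GL (Fin n) F) (B : Matrix (Fin n) (Fin n) F), IsAlternating (B + hᵀ * h) ∧
      fromBlocks (fromBlocks A X 0 D) (fromRows x y) (fromCols 0 h) c = paraMatrix A' B h := by
  have key : ∀ (u v : Fin n → F) (t : Fin 1 → F),
      (A *ᵥ u + X *ᵥ v + x *ᵥ t) ⬝ᵥ (D *ᵥ v + y *ᵥ t) + ((h *ᵥ v) 0 + c 0 0 * t 0) ^ 2 =
        u ⬝ᵥ v + t 0 ^ 2 := by
    intro u v t
    have h1 : fromBlocks (fromBlocks A X 0 D) (fromRows x y) (fromCols 0 h) c *ᵥ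
        Sum.elim (Sum.elim u v) t = Sum.elim (Sum.elim (A *ᵥ u + X *ᵥ v + x *ᵥ t)
          (D *ᵥ v + y *ᵥ t)) (h *ᵥ v + c *ᵥ t) := by
      ext ((_ | _) | _) <;>
        simp [fromBlocks_mulVec, fromCols_mulVec, fromRows_mulVec, Function.comp_def]
    have h2 : (c *ᵥ t) 0 = c 0 0 * t 0 := by simp [mulVec, dotProduct]
    have := hw (Sum.elim (Sum.elim u v) t)
    rwa [h1, theta_elim, theta_elim, Pi.add_apply, h2] at this
  have hX : ∀ v, (X *ᵥ v) ⬝ᵥ (D *ᵥ v) + (h *ᵥ v) 0 ^ 2 = 0 := fun v => by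
    simpa using key 0 v 0
  have hAD : Aᵀ * D = 1 := by
    have h1 : ∀ u v, (A *ᵥ u) ⬝ᵥ (D *ᵥ v) = u ⬝ᵥ v := fun u v => by
      have := key u v 0
      simp only [mulVec_zero, add_zero, add_dotProduct, Pi.zero_apply, mul_zero] at this
      linear_combination this - hX v
    refine ext_of_mulVec_single fun j => ?_
    ext i
    have := h1 (Pi.single i 1) (Pi.single j 1)
    rw [dotProduct_comm, dotProduct_mulVec, dotProduct_comm, ← mulVec_transpose,
      mulVec_mulVec] at this
    simpa [one_apply, Pi.single_apply, eq_comm] using this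
  have hDA : Dᵀ * A = 1 := by simpa using congrArg transpose hAD
  have hy : y = 0 := by
    have h1 : ∀ u t, (A *ᵥ u) ⬝ᵥ (y *ᵥ t) = 0 := fun u t => by
      have e1 := key u 0 t
      have e2 := key 0 0 t
      simp only [mulVec_zero, add_zero, zero_add, add_dotProduct, Pi.zero_apply,
        dotProduct_zero] at e1 e2
      linear_combination e1 - e2
    refine ext_of_mulVec_single fun j => ?_
    ext i
    have := h1 (Dᵀ *ᵥ Pi.single i 1) (Pi.single j 1)
    rw [mulVec_mulVec, mul_eq_one_comm.1 hDA, one_mulVec] at this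
    simpa using this
  subst hy
  have hc : c = 1 := by
    have h1 := key 0 0 (fun _ => 1)
    have h2 : c 0 0 = 1 := CharTwo.sq_injective (by simpa using h1)
    ext i j
    fin_cases i; fin_cases j
    simpa using h2
  subst hc
  have hx : x = 0 := by
    have h1 : ∀ v t, (x *ᵥ t) ⬝ᵥ (D *ᵥ v) = 0 := fun v t => by
      have e1 := key 0 v t
      simp only [mulVec_zero, add_zero, zero_add, add_dotProduct, zero_dotProduct,
        one_apply_eq, zero_mulVec, one_mul, CharTwo.add_sq] at e1
      linear_combination e1 - hX v
    refine ext_of_mulVec_single fun j => ?_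
    ext i
    have := h1 (Aᵀ *ᵥ Pi.single i 1) (Pi.single j 1)
    rw [mulVec_mulVec, mul_eq_one_comm.1 hAD, one_mulVec] at this
    simpa using this
  subst hx
  refine ⟨⟨A, Dᵀ, mul_eq_one_comm.1 hDA, hDA⟩, Dᵀ * X, ?_, ?_⟩
  · refine isAlt_iff_dotProduct_mulVec_self.2 fun v => ?_
    rw [add_mulVec, dotProduct_add, dotProduct_mulVec_transpose_mul_self, ← mulVec_mulVec,
      dotProduct_mulVec, vecMul_transpose, dotProduct_comm]
    exact hX v
  · change _ = fromBlocks (fromBlocks A (A * (Dᵀ * X)) 0 Dᵀᵀ) 0 (fromCols 0 h) 1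
    rw [← Matrix.mul_assoc, mul_eq_one_comm.1 hDA]
    simp

/-- Membership in the parabolic subgroup is the vanishing of the entries below `A`. -/
theorem mem_parabolic_iff {w : orthogonalGroup F n} :
    w ∈ parabolic F n ↔
      (∀ i j, ((w : GL (Idx n) F) : Matrix (Idx n) (Idx n) F) (Sum.inl (Sum.inr i))
        (Sum.inl (Sum.inl j)) = 0) ∧
      (∀ i j, ((w : GL (Idx n) F) : Matrix (Idx n) (Idx n) F) (Sum.inr i)
        (Sum.inl (Sum.inl j)) = 0) := by
  rw [mem_parabolic_iff_exists]
  constructor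
  · rintro ⟨A, B, h, -, hw⟩
    simp [hw, paraMatrix]
  · rintro ⟨h1, h2⟩
    set W := ((w : GL (Idx n) F) : Matrix (Idx n) (Idx n) F) with hW
    have e : W = fromBlocks (fromBlocks W.toBlocks₁₁.toBlocks₁₁ W.toBlocks₁₁.toBlocks₁₂ 0
        W.toBlocks₁₁.toBlocks₂₂) (fromRows W.toBlocks₁₂.toRows₁ W.toBlocks₁₂.toRows₂)
        (fromCols 0 W.toBlocks₂₁.toCols₂) W.toBlocks₂₂ := by
      ext ((i | i) | i) ((j | j) | j) <;>
        simp [toBlocks₁₁, toBlocks₁₂, toBlocks₂₁, toBlocks₂₂, h1, h2]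
    have hw : ∀ z, theta n (W *ᵥ z) = theta n z := w.2
    rw [e] at hw
    obtain ⟨A, B, hB, h⟩ := eq_paraMatrix_of_isometry hw
    exact ⟨A, B, _, hB, e.trans h⟩

variable (F n) in
/-- The parabolic subgroup, as a subgroup. -/
def parabolicSubgroup [Finite F] : Subgroup (orthogonalGroup F n) :=
  let M : Submonoid (orthogonalGroup F n) :=
    { carrier := parabolic F n
      one_mem' := by simp [mem_parabolic_iff]
      mul_mem' := by
        intro a b ha hb
        rw [mem_parabolic_iff] at *
        simp [Matrix.mul_apply, Fintype.sum_sum_type, ha.1, ha.2, hb.1, hb.2] }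
  { M with
    inv_mem' := by
      intro w hw
      have h : w⁻¹ = w ^ (orderOf w - 1) := by
        refine inv_eq_of_mul_eq_one_right ?_
        rw [← pow_succ', Nat.sub_add_cancel (orderOf_pos w), pow_orderOf_eq_one]
      change w⁻¹ ∈ M
      rw [h]
      exact M.pow_mem hw _ }

theorem mem_parabolicSubgroup [Finite F] {w : orthogonalGroup F n} :
    w ∈ parabolicSubgroup F n ↔ w ∈ parabolic F n := Iff.rfl

theorem isAlternating_add_iff {B : Matrix (Fin n) (Fin n) F} {h : Matrix (Fin 1) (Fin n) F} :
    IsAlternating (B + hᵀ * h) ↔ B.IsSymm ∧ ∀ i, B i i = h 0 i ^ 2 := by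
  have e : ∀ i j, (hᵀ * h) i j = h 0 i * h 0 j := fun i j => by simp [Matrix.mul_apply]
  simp only [IsAlternating, Matrix.add_apply, e, CharTwo.neg_eq, CharTwo.add_eq_zero, ← sq]
  rw [and_comm]
  refine and_congr_left fun _ => ⟨fun H => IsSymm.ext fun i j => ?_, fun H i j => ?_⟩
  · have := H j i
    rw [mul_comm (h 0 j)] at this
    exact add_right_cancel this
  · rw [H.apply i j, mul_comm]

/-- The row of square roots of the diagonal entries. -/
noncomputable def sqrtDiag [Finite F] (B : Matrix (Fin n) (Fin n) F) : Matrix (Fin 1) (Fin n) F :=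
  of fun _ i => (frobeniusEquiv F 2).symm (B i i)

theorem sqrtDiag_sq [Finite F] (B : Matrix (Fin n) (Fin n) F) (i : Fin n) :
    sqrtDiag B 0 i ^ 2 = B i i :=
  frobeniusEquiv_symm_pow_p F 2 _

theorem isAlternating_add_sqrtDiag [Finite F] {B : Matrix (Fin n) (Fin n) F} (hB : B.IsSymm) :
    IsAlternating (B + (sqrtDiag B)ᵀ * sqrtDiag B) :=
  isAlternating_add_iff.2 ⟨hB, fun i => (sqrtDiag_sq B i).symm⟩

/-- The parabolic subgroup is parametrized by an invertible and a symmetric matrix. -/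
noncomputable def parabolicEquiv [Finite F] :
    GL (Fin n) F × {B : Matrix (Fin n) (Fin n) F // B.IsSymm} ≃ parabolicSubgroup F n :=
  Equiv.ofBijective (fun x => ⟨para x.1 (isAlternating_add_sqrtDiag x.2.2),
      mem_parabolic_iff_exists.2 ⟨_, _, _, isAlternating_add_sqrtDiag x.2.2, rfl⟩⟩) <| by
    constructor
    · rintro ⟨A, B, hB⟩ ⟨A', B', hB'⟩ h
      have h : paraMatrix A B (sqrtDiag B) = paraMatrix A' B' (sqrtDiag B') :=
        congrArg (fun w : parabolicSubgroup F n =>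
          (((w : orthogonalGroup F n) : GL (Idx n) F) : Matrix (Idx n) (Idx n) F)) h
      have h1 := (fromBlocks_inj.1 (fromBlocks_inj.1 h).1)
      obtain rfl : A = A' := Units.ext h1.1
      have h2 := congrArg (((A⁻¹ : GL (Fin n) F) : Matrix (Fin n) (Fin n) F) * ·) h1.2.1
      simp only [← Matrix.mul_assoc, GL_inv_mul, Matrix.one_mul] at h2
      subst h2
      rfl
    · rintro ⟨w, hw⟩
      obtain ⟨A, B, h, hB, e⟩ := mem_parabolic_iff_exists.1 hw
      have h0 := isAlternating_add_iff.1 hB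
      obtain rfl : sqrtDiag B = h := by
        ext k i
        obtain rfl := Subsingleton.elim k 0
        exact CharTwo.sq_injective ((sqrtDiag_sq B i).trans (h0.2 i))
      exact ⟨(A, ⟨B, h0.1⟩), Subtype.ext (Subtype.ext (Units.ext e.symm))⟩

end Parabolic

section Glue

variable {F : Type*} {r : ℕ}

/-- The square matrix with upper left block `D`, last column `(c, a)` and last row `(v, a)`. -/
def glue (D : Matrix (Fin r) (Fin r) F) (c v : Fin r → F) (a : F) :
    Matrix (Fin (r + 1)) (Fin (r + 1)) F :=
  of fun i j => Fin.lastCases (motive := fun _ => F) (Fin.lastCases (motive := fun _ => F) a v j)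
    (fun i => Fin.lastCases (motive := fun _ => F) (c i) (D i) j) i

section

variable (D : Matrix (Fin r) (Fin r) F) (c v : Fin r → F) (a : F) (i j : Fin r)

@[simp] theorem glue_castSucc_castSucc : glue D c v a i.castSucc j.castSucc = D i j := by
  simp [glue]

@[simp] theorem glue_castSucc_last : glue D c v a i.castSucc (Fin.last r) = c i := by simp [glue]

@[simp] theorem glue_last_castSucc : glue D c v a (Fin.last r) j.castSucc = v j := by simp [glue]

@[simp] theorem glue_last_last : glue D c v a (Fin.last r) (Fin.last r) = a := by simp [glue]

@[simp] theorem submatrix_glue : (glue D c v a).submatrix Fin.castSucc Fin.castSucc = D := by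
  ext; simp

end

theorem ext_castSucc {M N : Matrix (Fin (r + 1)) (Fin (r + 1)) F}
    (h1 : ∀ i j : Fin r, M i.castSucc j.castSucc = N i.castSucc j.castSucc)
    (h2 : ∀ i : Fin r, M i.castSucc (Fin.last r) = N i.castSucc (Fin.last r))
    (h3 : ∀ j : Fin r, M (Fin.last r) j.castSucc = N (Fin.last r) j.castSucc)
    (h4 : M (Fin.last r) (Fin.last r) = N (Fin.last r) (Fin.last r)) : M = N := by
  ext i j
  induction i using Fin.lastCases <;> induction j using Fin.lastCases <;> simp [*]

theorem isSymm_glue {D : Matrix (Fin r) (Fin r) F} (hD : D.IsSymm) (v : Fin r → F) (a : F) :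
    (glue D v v a).IsSymm :=
  ext_castSucc (by simp [hD.apply]) (by simp) (by simp) (by simp)

/-- A symmetric matrix consists of its upper left block and its last row. -/
def symmEquiv (Q : Matrix (Fin r) (Fin r) F → Prop) :
    {B : {B : Matrix (Fin (r + 1)) (Fin (r + 1)) F // B.IsSymm} //
      Q (B.1.submatrix Fin.castSucc Fin.castSucc)} ≃
    {D : {D : Matrix (Fin r) (Fin r) F // D.IsSymm} // Q D} × (Fin r → F) × F where
  toFun B := (⟨⟨_, B.1.2.submatrix _⟩, B.2⟩, fun j => B.1.1 (Fin.last r) j.castSucc,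
    B.1.1 (Fin.last r) (Fin.last r))
  invFun x := ⟨⟨glue x.1.1.1 x.2.1 x.2.1 x.2.2, isSymm_glue x.1.1.2 _ _⟩, by
    rw [submatrix_glue]; exact x.1.2⟩
  left_inv B := by
    refine Subtype.ext (Subtype.ext (ext_castSucc ?_ ?_ ?_ ?_)) <;> simp [B.1.2.apply]
  right_inv x := by
    ext <;> simp

variable [Field F]

theorem det_of_last_col_eq_zero {M : Matrix (Fin (r + 1)) (Fin (r + 1)) F}
    (h : ∀ i : Fin r, M i.castSucc (Fin.last r) = 0) :
    M.det = (M.submatrix Fin.castSucc Fin.castSucc).det * M (Fin.last r) (Fin.last r) := by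
  rw [det_succ_column M (Fin.last r), Fin.sum_univ_castSucc]
  simp [h, Fin.succAbove_last, ← two_mul, mul_comm]

/-- Block lower triangular invertible matrices. -/
def lowerEquiv (Q : Matrix (Fin r) (Fin r) F → Prop) (R : F → Prop) :
    {M : Matrix (Fin (r + 1)) (Fin (r + 1)) F // M.det ≠ 0 ∧
      (∀ i : Fin r, M i.castSucc (Fin.last r) = 0) ∧
        Q (M.submatrix Fin.castSucc Fin.castSucc) ∧ R (M (Fin.last r) (Fin.last r))} ≃
    {D : Matrix (Fin r) (Fin r) F // Q D ∧ D.det ≠ 0} × {a : F // a ≠ 0 ∧ R a} × (Fin r → F) where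
  toFun M := (⟨M.1.submatrix Fin.castSucc Fin.castSucc, M.2.2.2.1, fun h => M.2.1 <| by
      rw [det_of_last_col_eq_zero M.2.2.1, h, zero_mul]⟩,
    ⟨M.1 (Fin.last r) (Fin.last r), fun h => M.2.1 <| by
      rw [det_of_last_col_eq_zero M.2.2.1, h, mul_zero], M.2.2.2.2⟩,
    fun j => M.1 (Fin.last r) j.castSucc)
  invFun x := ⟨glue x.1.1 0 x.2.2 x.2.1.1, by
    rw [det_of_last_col_eq_zero (by simp)]
    simpa using ⟨x.1.2.2, x.2.1.2.1⟩, by simp, by simpa using x.1.2.1, by simpa using x.2.1.2.2⟩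
  left_inv M := by
    refine Subtype.ext (ext_castSucc ?_ ?_ ?_ ?_) <;> simp [M.2.2.1]
  right_inv x := by
    ext <;> simp

/-- Invertible matrices as matrices with nonzero determinant. -/
def glEquiv (ι : Type*) [Fintype ι] [DecidableEq ι] (P : Matrix ι ι F → Prop) :
    {A : GL ι F // P A} ≃ {M : Matrix ι ι F // M.det ≠ 0 ∧ P M} where
  toFun := fun A => ⟨A.1, A.1.det_ne_zero, A.2⟩
  invFun := fun M => ⟨GeneralLinearGroup.mkOfDetNeZero M.1 M.2.1, M.2.2⟩
  left_inv := fun _ => Subtype.ext (Units.ext rfl)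
  right_inv := fun _ => rfl

variable [Fintype F]

theorem card_symm (r : ℕ) : Nat.card {B : Matrix (Fin r) (Fin r) F // B.IsSymm} =
    Fintype.card F ^ Nat.choose (r + 1) 2 := by
  induction r with
  | zero =>
    rw [zero_add, Nat.choose_eq_zero_of_lt one_lt_two, pow_zero, Nat.card_eq_one_iff_unique]
    exact ⟨⟨fun a b => Subtype.ext (Subsingleton.elim _ _)⟩, ⟨0, Subsingleton.elim _ _⟩⟩
  | succ r ih =>
    have h := Nat.card_congr (symmEquiv (F := F) (r := r) fun _ => True)
    rw [Nat.card_prod, Nat.card_prod, Nat.card_congr (Equiv.subtypeUnivEquiv fun _ => trivial),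
      Nat.card_congr (Equiv.subtypeUnivEquiv fun _ => trivial), ih] at h
    rw [h, Nat.choose_succ_succ' (r + 1) 1, Nat.choose_one_right, pow_add, pow_succ]
    simp [mul_comm]

theorem card_symm_of_block_eq_zero (r : ℕ) :
    Nat.card {B : {B : Matrix (Fin (r + 1)) (Fin (r + 1)) F // B.IsSymm} //
      ∀ i j : Fin r, B.1 i.castSucc j.castSucc = 0} = Fintype.card F ^ (r + 1) := by
  have h := Nat.card_congr (symmEquiv (F := F) (r := r) fun D => ∀ i j, D i j = 0)
  have h1 : Nat.card {D : {D : Matrix (Fin r) (Fin r) F // D.IsSymm} // ∀ i j, D.1 i j = 0} = 1 := by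
    rw [Nat.card_eq_one_iff_unique]
    refine ⟨⟨fun a b => ?_⟩, ⟨⟨⟨0, isSymm_zero⟩, by simp⟩⟩⟩
    ext i j
    rw [a.2, b.2]
  rw [Nat.card_prod, Nat.card_prod, h1] at h
  simpa [pow_succ] using h

theorem card_lower (Q : Matrix (Fin r) (Fin r) F → Prop) (R : F → Prop) :
    Nat.card {A : GL (Fin (r + 1)) F // (∀ i : Fin r, A i.castSucc (Fin.last r) = 0) ∧
        Q ((A : Matrix _ _ F).submatrix Fin.castSucc Fin.castSucc) ∧
          R (A (Fin.last r) (Fin.last r))} =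
      Nat.card {D : Matrix (Fin r) (Fin r) F // Q D ∧ D.det ≠ 0} *
        (Nat.card {a : F // a ≠ 0 ∧ R a} * Fintype.card F ^ r) := by
  rw [Nat.card_congr (glEquiv (F := F) (Fin (r + 1))
    fun M => (∀ i : Fin r, M i.castSucc (Fin.last r) = 0) ∧
        Q (M.submatrix Fin.castSucc Fin.castSucc) ∧ R (M (Fin.last r) (Fin.last r))),
    Nat.card_congr (lowerEquiv Q R), Nat.card_prod, Nat.card_prod]
  simp

/-- All the fibers of a nonzero linear functional have the same cardinality. -/
theorem card_mul_card_fiber {V : Type*} [AddCommGroup V] [Module F V] {φ : V →ₗ[F] F} (hφ : φ ≠ 0)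
    (c : F) : Fintype.card F * Nat.card {v // φ v = c} = Nat.card V := by
  obtain ⟨v, hv⟩ : ∃ v, φ v = 1 := by
    obtain ⟨v, hv⟩ := DFunLike.ne_iff.1 hφ
    exact ⟨(φ v)⁻¹ • v, by simpa using inv_mul_cancel₀ hv⟩
  rw [← Nat.card_eq_fintype_card, ← Nat.card_prod]
  exact Nat.card_congr
    { toFun := fun x => x.2.1 + x.1 • v
      invFun := fun w => (φ w - c, ⟨w - (φ w - c) • v, by simp [hv]⟩)
      left_inv := fun x => by ext <;> simp [hv, x.2.2]
      right_inv := fun w => by simp }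

end Glue

section Functional

variable {F : Type*} [Field F] {r : ℕ}

variable (F r) in
/-- The space of symmetric matrices. -/
def symmSubmodule : Submodule F (Matrix (Fin (r + 1)) (Fin (r + 1)) F) where
  carrier := {B | B.IsSymm}
  add_mem' := IsSymm.add
  zero_mem' := isSymm_zero
  smul_mem' c _ hB := hB.smul c

/-- The functional `B ↦ ∑_{i < r} (A * B)_{ii}` on symmetric matrices. -/
def partialTrace (A : Matrix (Fin (r + 1)) (Fin (r + 1)) F) : symmSubmodule F r →ₗ[F] F where
  toFun B := ∑ i : Fin r, (A * B.1) i.castSucc i.castSucc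
  map_add' B C := by simp [Matrix.mul_add, Finset.sum_add_distrib]
  map_smul' c B := by simp [Finset.mul_sum]

/-- The condition that `B ↦ ∑_{i < r} (A * B)_{ii}` vanishes on all symmetric matrices. -/
def Degenerate (A : Matrix (Fin (r + 1)) (Fin (r + 1)) F) : Prop :=
  (∀ i : Fin r, A i.castSucc (Fin.last r) = 0) ∧ IsAlt (A.submatrix Fin.castSucc Fin.castSucc)

theorem partialTrace_eq_zero_iff (A : Matrix (Fin (r + 1)) (Fin (r + 1)) F) :
    partialTrace A = 0 ↔ Degenerate A := by
  constructor
  · intro h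
    have h1 : ∀ (u : Fin r → F) (a : F),
        u ⬝ᵥ A.submatrix Fin.castSucc Fin.castSucc *ᵥ u +
          a * ∑ i, u i * A i.castSucc (Fin.last r) = 0 := by
      intro u a
      let v : Fin (r + 1) → F := Fin.snoc (α := fun _ => F) u a
      have hs : (vecMulVec v v).IsSymm := IsSymm.ext fun i j => by
        simp [vecMulVec_apply, mul_comm]
      have := DFunLike.congr_fun h ⟨vecMulVec v v, hs⟩
      simp only [partialTrace, LinearMap.coe_mk, AddHom.coe_mk, mul_vecMulVec, LinearMap.zero_apply,
        vecMulVec_apply, mulVec, dotProduct, Fin.sum_univ_castSucc, v, Fin.snoc_castSucc,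
        Fin.snoc_last] at this
      rw [← this, Finset.mul_sum, dotProduct, ← Finset.sum_add_distrib]
      refine Finset.sum_congr rfl fun i _ => ?_
      simp only [mulVec, dotProduct, submatrix_apply]
      ring
    have h2 : IsAlt (A.submatrix Fin.castSucc Fin.castSucc) :=
      isAlt_iff_dotProduct_mulVec_self.2 fun u => by simpa using h1 u 0
    refine ⟨fun i => ?_, h2⟩
    have := h1 (Pi.single i 1) 1
    rw [h2.dotProduct_mulVec_self] at this
    simpa [Pi.single_apply] using this
  · rintro ⟨h1, h2⟩
    ext ⟨B, hB⟩
    simp only [partialTrace, LinearMap.coe_mk, AddHom.coe_mk, LinearMap.zero_apply,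
      Matrix.mul_apply, Fin.sum_univ_castSucc, h1, zero_mul, add_zero]
    rw [← Finset.sum_product']
    refine Finset.sum_involution (fun p _ => (p.2, p.1)) ?_ ?_ (by simp) (by simp)
    · rintro ⟨i, j⟩ -
      have := h2.2 i j
      simp only [submatrix_apply] at this
      rw [this, hB.apply i.castSucc]
      ring
    · rintro ⟨i, j⟩ - h h'
      obtain rfl : j = i := congrArg Prod.fst h'
      have := h2.1 j
      simp only [submatrix_apply] at this
      exact h (by simp [this])

end Functional

section Count

variable {F : Type*} [Field F] {r : ℕ}

theorem GL_inv_last_mul_last {A : GL (Fin (r + 1)) F}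
    (hA : ∀ i : Fin r, A i.castSucc (Fin.last r) = 0) (j : Fin (r + 1)) :
    (A⁻¹ : GL (Fin (r + 1)) F) j (Fin.last r) * A (Fin.last r) (Fin.last r) =
      if j = Fin.last r then 1 else 0 := by
  have := congrFun (congrFun (GL_inv_mul A) j) (Fin.last r)
  simpa only [Matrix.mul_apply, Fin.sum_univ_castSucc, hA, mul_zero, Finset.sum_const_zero, zero_add,
    one_apply] using this

theorem GL_last_last_ne_zero {A : GL (Fin (r + 1)) F}
    (hA : ∀ i : Fin r, A i.castSucc (Fin.last r) = 0) : A (Fin.last r) (Fin.last r) ≠ 0 := by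
  intro h
  simpa [h] using GL_inv_last_mul_last hA (Fin.last r)

theorem trace_paraMatrix_mul_sigma (A : GL (Fin (r + 1)) F)
    (B : Matrix (Fin (r + 1)) (Fin (r + 1)) F) (h : Matrix (Fin 1) (Fin (r + 1)) F) :
    trace (paraMatrix A B h * sigmaMatrix F (r + 1) r) =
      A (Fin.last r) (Fin.last r) + (A⁻¹ : GL (Fin (r + 1)) F) (Fin.last r) (Fin.last r) + 1 +
        ∑ i : Fin r, ((A : Matrix (Fin (r + 1)) (Fin (r + 1)) F) * B) i.castSucc i.castSucc := by
  simp only [paraMatrix, sigmaMatrix, fromBlocks_multiply, tailOne, headOne,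
    Matrix.zero_mul, Matrix.mul_zero, Matrix.mul_one, add_zero, zero_add, trace, diag_apply,
    Fintype.sum_sum_type, fromBlocks_apply₁₁, fromBlocks_apply₂₂, Matrix.add_apply, mul_diagonal,
    Fin.sum_univ_castSucc, transpose_apply]
  simp [-coe_units_inv]
  ring

theorem sigma_inv (n k : ℕ) : (sigma F n k)⁻¹ = sigma F n k := by
  rw [inv_eq_iff_mul_eq_one]
  exact Subtype.ext (Units.ext (sigmaMatrix_mul_self n k))

variable [CharP F 2] [Finite F]

theorem sigma_conj_mem_iff (x : GL (Fin (r + 1)) F ×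
      {B : Matrix (Fin (r + 1)) (Fin (r + 1)) F // B.IsSymm}) :
    (sigma F (r + 1) r)⁻¹ * (parabolicEquiv x : orthogonalGroup F (r + 1)) * sigma F (r + 1) r ∈
        parabolicSubgroup F (r + 1) ↔
      (∀ i : Fin r, x.1 i.castSucc (Fin.last r) = 0) ∧
        ∀ i j : Fin r, x.2.1 i.castSucc j.castSucc = 0 := by
  obtain ⟨A, B, hB⟩ := x
  rw [sigma_inv, mem_parabolicSubgroup, mem_parabolic_iff]
  have e : (((sigma F (r + 1) r * (parabolicEquiv (A, ⟨B, hB⟩) : orthogonalGroup F (r + 1)) *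
      sigma F (r + 1) r : orthogonalGroup F (r + 1)) : GL (Idx (r + 1)) F) :
        Matrix (Idx (r + 1)) (Idx (r + 1)) F) =
      sigmaMatrix F (r + 1) r * paraMatrix A B (sqrtDiag B) * sigmaMatrix F (r + 1) r := rfl
  simp only [e, paraMatrix, sigmaMatrix, fromBlocks_multiply, tailOne, headOne, fromBlocks_apply₁₁,
    fromBlocks_apply₂₁, fromCols_mul_fromBlocks, fromCols_apply_inl,
    Matrix.zero_mul, Matrix.mul_zero, Matrix.mul_one, Matrix.one_mul, add_zero, zero_add,
    Matrix.add_apply, diagonal_mul, mul_diagonal, transpose_apply]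
  have hsplit : ∀ p : Fin (r + 1) → Prop, (∀ i, p i) ↔ (∀ i : Fin r, p i.castSucc) ∧ p (Fin.last r) :=
    fun p => ⟨fun h => ⟨fun i => h _, h _⟩, fun h i => Fin.lastCases h.2 h.1 i⟩
  simp only [hsplit]
  simp only [Fin.val_castSucc, Fin.is_lt, ↓reduceIte, one_mul, mul_zero, zero_mul, add_zero, mul_one,
    zero_add, Fin.val_last, lt_self_iff_false, and_true, Fin.forall_fin_one, Fin.isValue]
  constructor
  · rintro ⟨⟨h1, h2⟩, h3⟩
    refine ⟨fun i => (h1 i).2, fun i j => ?_⟩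
    have hBA : B = ((A⁻¹ : GL (Fin (r + 1)) F) : Matrix _ _ F) * ((A : Matrix _ _ F) * B) := by
      rw [← Matrix.mul_assoc, GL_inv_mul, Matrix.one_mul]
    rw [hBA, Matrix.mul_apply, Fin.sum_univ_castSucc, h2 i]
    simp [(h1 _).1]
  · rintro ⟨h1, h2⟩
    refine ⟨⟨fun i => ⟨fun j => ?_, h1 i⟩, fun j => ?_⟩, fun j => ?_⟩
    · rw [Matrix.mul_apply, Fin.sum_univ_castSucc, h1 i]
      simp [h2]
    · have := GL_inv_last_mul_last h1 j.castSucc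
      rw [if_neg (Fin.castSucc_lt_last j).ne] at this
      exact (mul_eq_zero.1 this).resolve_right (GL_last_last_ne_zero h1)
    · have := sqrtDiag_sq B j.castSucc
      rw [h2 j j] at this
      exact pow_eq_zero_iff two_ne_zero |>.1 this

end Count

section Main

variable {F : Type*} [Field F] [Fintype F] {r : ℕ}

theorem card_ne_zero_and_true : Nat.card {a : F // a ≠ 0 ∧ True} = Fintype.card F - 1 := by
  classical
  rw [← Fintype.card_units, ← Nat.card_eq_fintype_card]
  exact Nat.card_congr ((Equiv.subtypeEquivRight fun a => by rw [and_true]).trans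
    unitsEquivNeZero.symm)

theorem card_degenerate_of (R : F → Prop) :
    Nat.card {A : GL (Fin (r + 1)) F // Degenerate (F := F) (r := r) A ∧
        R (A (Fin.last r) (Fin.last r))} =
      altCount F (Fin r) * (Nat.card {a : F // a ≠ 0 ∧ R a} * Fintype.card F ^ r) := by
  rw [altCount, ← card_lower IsAlt R]
  exact Nat.card_congr (Equiv.subtypeEquivRight fun A => and_assoc)

theorem card_degenerate :
    Nat.card {A : GL (Fin (r + 1)) F // Degenerate (F := F) (r := r) A} =
      altCount F (Fin r) * ((Fintype.card F - 1) * Fintype.card F ^ r) := by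
  classical
  rw [← card_ne_zero_and_true, ← card_degenerate_of]
  exact Nat.card_congr (Equiv.subtypeEquivRight fun A => by simp)

theorem card_degenerate_inv (β : F) :
    Nat.card {A : GL (Fin (r + 1)) F // Degenerate (F := F) (r := r) A ∧
        A (Fin.last r) (Fin.last r) + (A⁻¹ : GL (Fin (r + 1)) F) (Fin.last r) (Fin.last r) + 1 = β} =
      altCount F (Fin r) * (invCount β * Fintype.card F ^ r) := by
  rw [invCount, ← card_degenerate_of fun a => a + a⁻¹ + 1 = β]
  refine Nat.card_congr (Equiv.subtypeEquivRight fun A => and_congr_right fun hA => ?_)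
  have h := GL_inv_last_mul_last hA.1 (Fin.last r)
  rw [if_pos rfl] at h
  rw [eq_inv_of_mul_eq_one_left h]

/-- The number of symmetric `B` for which the trace attached to `(A, B)` is `β`. -/
theorem card_fiber_add (A : GL (Fin (r + 1)) F) (β : F) [Decidable (Degenerate (F := F) (r := r) A)]
    [DecidableEq F] :
    Fintype.card F * Nat.card {B : {B : Matrix (Fin (r + 1)) (Fin (r + 1)) F // B.IsSymm} //
        A (Fin.last r) (Fin.last r) + (A⁻¹ : GL (Fin (r + 1)) F) (Fin.last r) (Fin.last r) + 1 +
        ∑ i : Fin r, ((A : Matrix (Fin (r + 1)) (Fin (r + 1)) F) * B.1) i.castSucc i.castSucc = β} +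
      Fintype.card F ^ Nat.choose (r + 2) 2 * (if Degenerate (F := F) (r := r) A then 1 else 0) =
    Fintype.card F ^ Nat.choose (r + 2) 2 + Fintype.card F * Fintype.card F ^ Nat.choose (r + 2) 2 *
      (if Degenerate (F := F) (r := r) A ∧ A (Fin.last r) (Fin.last r) +
        (A⁻¹ : GL (Fin (r + 1)) F) (Fin.last r) (Fin.last r) + 1 = β then 1 else 0) := by
  set t := A (Fin.last r) (Fin.last r) +
    (A⁻¹ : GL (Fin (r + 1)) F) (Fin.last r) (Fin.last r) + 1
  have hS : Nat.card (symmSubmodule F r) = Fintype.card F ^ Nat.choose (r + 2) 2 :=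
    card_symm (F := F) (r + 1)
  have e : Nat.card {B : {B : Matrix (Fin (r + 1)) (Fin (r + 1)) F // B.IsSymm} // t +
      ∑ i : Fin r, ((A : Matrix (Fin (r + 1)) (Fin (r + 1)) F) * B.1) i.castSucc i.castSucc = β} =
      Nat.card {B : symmSubmodule F r // partialTrace (A : Matrix _ _ F) B = β - t} :=
    Nat.card_congr (Equiv.subtypeEquivRight fun B => eq_sub_iff_add_eq'.symm)
  rw [e]
  by_cases hA : Degenerate (F := F) (r := r) A
  · rw [(partialTrace_eq_zero_iff _).2 hA]
    by_cases hb : t = β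
    · rw [Nat.card_congr (Equiv.subtypeUnivEquiv fun B => by simp [hb]), hS]
      simp [hA, hb, add_comm]
    · have : IsEmpty {B : symmSubmodule F r // (0 : symmSubmodule F r →ₗ[F] F) B = β - t} :=
        ⟨fun B => hb (sub_eq_zero.1 B.2.symm).symm⟩
      simp [hA, hb]
  · rw [card_mul_card_fiber (fun h => hA ((partialTrace_eq_zero_iff _).1 h)), hS]
    simp [hA]

variable [CharP F 2]

theorem card_parabolicSubgroup :
    Nat.card (parabolicSubgroup F (r + 1)) =
      Nat.card (GL (Fin (r + 1)) F) * Fintype.card F ^ Nat.choose (r + 2) 2 := by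
  rw [← Nat.card_congr parabolicEquiv, Nat.card_prod, card_symm]

theorem card_stabilizer :
    Nat.card {p : parabolicSubgroup F (r + 1) //
        (sigma F (r + 1) r)⁻¹ * (p : orthogonalGroup F (r + 1)) * sigma F (r + 1) r ∈
          parabolicSubgroup F (r + 1)} =
      Nat.card (GL (Fin r) F) * ((Fintype.card F - 1) * Fintype.card F ^ r) *
        Fintype.card F ^ (r + 1) := by
  classical
  rw [← Nat.card_congr (parabolicEquiv.subtypeEquiv fun x => (sigma_conj_mem_iff x).symm),
    Nat.card_congr (Equiv.subtypeProdEquivProd (p := fun A : GL (Fin (r + 1)) F =>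
        ∀ i : Fin r, A i.castSucc (Fin.last r) = 0)
      (q := fun B : {B : Matrix (Fin (r + 1)) (Fin (r + 1)) F // B.IsSymm} =>
        ∀ i j : Fin r, B.1 i.castSucc j.castSucc = 0)), Nat.card_prod, card_symm_of_block_eq_zero]
  congr 1
  have h := card_lower (F := F) (r := r) (fun _ => True) (fun _ => True)
  have h2 : Nat.card {D : Matrix (Fin r) (Fin r) F // True ∧ D.det ≠ 0} =
      Nat.card (GL (Fin r) F) := by
    rw [← Nat.card_congr (Equiv.subtypeUnivEquiv (α := GL (Fin r) F) (p := fun _ => True)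
      fun _ => trivial), Nat.card_congr (glEquiv (F := F) (Fin r) fun _ => True)]
    exact Nat.card_congr (Equiv.subtypeEquivRight fun A => and_comm)
  rw [card_ne_zero_and_true, h2] at h
  rw [← h]
  exact Nat.card_congr (Equiv.subtypeEquivRight fun A => by simp)

theorem card_trace_mul_sigma (β : F) :
    Fintype.card F * Nat.card {p : parabolicSubgroup F (r + 1) //
        trace ((((p : orthogonalGroup F (r + 1)) * sigma F (r + 1) r : orthogonalGroup F (r + 1)) :
          GL (Idx (r + 1)) F) : Matrix (Idx (r + 1)) (Idx (r + 1)) F) = β} +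
      Fintype.card F ^ Nat.choose (r + 2) 2 *
        (altCount F (Fin r) * ((Fintype.card F - 1) * Fintype.card F ^ r)) =
    Fintype.card F ^ Nat.choose (r + 2) 2 * Nat.card (GL (Fin (r + 1)) F) +
      Fintype.card F * Fintype.card F ^ Nat.choose (r + 2) 2 *
        (altCount F (Fin r) * (invCount β * Fintype.card F ^ r)) := by
  classical
  let t (A : GL (Fin (r + 1)) F) (B : {B : Matrix (Fin (r + 1)) (Fin (r + 1)) F // B.IsSymm}) : F :=
    A (Fin.last r) (Fin.last r) + (A⁻¹ : GL (Fin (r + 1)) F) (Fin.last r) (Fin.last r) + 1 +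
      ∑ i : Fin r, ((A : Matrix (Fin (r + 1)) (Fin (r + 1)) F) * B.1) i.castSucc i.castSucc
  have e : Nat.card {p : parabolicSubgroup F (r + 1) //
        trace ((((p : orthogonalGroup F (r + 1)) * sigma F (r + 1) r : orthogonalGroup F (r + 1)) :
          GL (Idx (r + 1)) F) : Matrix (Idx (r + 1)) (Idx (r + 1)) F) = β} =
      ∑ A : GL (Fin (r + 1)) F, Nat.card {B // t A B = β} := by
    rw [← Nat.card_sigma, ← Nat.card_congr (Equiv.subtypeProdEquivSigmaSubtype fun A B => t A B = β)]
    refine (Nat.card_congr (parabolicEquiv.subtypeEquiv fun x => ?_)).symm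
    rw [show t x.1 x.2 = _ from (trace_paraMatrix_mul_sigma x.1 x.2.1 (sqrtDiag x.2.1)).symm]
    rfl
  rw [← card_degenerate, ← card_degenerate_inv, e, Nat.card_eq_fintype_card,
    Nat.card_eq_fintype_card, Nat.card_eq_fintype_card, Fintype.card_subtype,
    Fintype.card_subtype, Finset.card_filter, Finset.card_filter,
    Fintype.card_eq_sum_ones (α := GL (Fin (r + 1)) F)]
  simp only [Finset.mul_sum, ← Finset.sum_add_distrib, mul_one]
  exact Finset.sum_congr rfl fun A _ => card_fiber_add A β

theorem traceCount_mul (β : F) :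
    Nat.card (GL (Fin r) F) * ((Fintype.card F - 1) * Fintype.card F ^ r) *
        Fintype.card F ^ (r + 1) * traceCount (r + 1) β =
      Nat.card (GL (Fin (r + 1)) F) * Fintype.card F ^ Nat.choose (r + 2) 2 *
        Nat.card {p : parabolicSubgroup F (r + 1) //
        trace ((((p : orthogonalGroup F (r + 1)) * sigma F (r + 1) r : orthogonalGroup F (r + 1)) :
          GL (Idx (r + 1)) F) : Matrix (Idx (r + 1)) (Idx (r + 1)) F) = β} := by
  rw [← card_stabilizer, ← card_parabolicSubgroup]
  exact card_inter_mul_ncard_doubleCoset (parabolicSubgroup F (r + 1)) (sigma F (r + 1) r)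
    (fun w => trace ((w : GL (Idx (r + 1)) F) : Matrix (Idx (r + 1)) (Idx (r + 1)) F))
    (fun a b => trace_mul_comm _ _) β

end Main

section Coefficients

/-- The order of the general linear group, as a rational number. -/
def glOrder (q : ℚ) (m : ℕ) : ℚ := ∏ i ∈ Finset.range m, (q ^ m - q ^ i)

theorem glOrder_succ (q : ℚ) (m : ℕ) :
    glOrder q (m + 1) = (q ^ (m + 1) - 1) * q ^ m * glOrder q m := by
  have h : ∀ i ∈ Finset.range m, q ^ (m + 1) - q ^ (i + 1) = q * (q ^ m - q ^ i) :=
    fun i _ => by ring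
  rw [glOrder, Finset.prod_range_succ', Finset.prod_congr rfl h, Finset.prod_mul_distrib, glOrder]
  simp
  ring

theorem glOrder_two_mul (q : ℚ) (k : ℕ) :
    glOrder q (2 * k) = q ^ (k ^ 2) * q ^ (k * (k - 1)) *
      (∏ j ∈ Finset.Icc 1 k, (q ^ (2 * j - 1) - 1)) * ∏ j ∈ Finset.Icc 1 k, (q ^ (2 * j) - 1) := by
  induction k with
  | zero => simp [glOrder]
  | succ k ih =>
    rw [show 2 * (k + 1) = 2 * k + 1 + 1 by ring, glOrder_succ, glOrder_succ, ih,
      Finset.prod_Icc_succ_top (by omega), Finset.prod_Icc_succ_top (by omega),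
      show 2 * (k + 1) - 1 = 2 * k + 1 by omega, show 2 * (k + 1) = 2 * k + 1 + 1 by ring,
      Nat.add_sub_cancel, show (k + 1) * k = 2 * k + k * (k - 1) by
        rcases k with _ | k
        · rfl
        · simp only [Nat.add_sub_cancel]; ring]
    ring

theorem card_GL_eq_glOrder {F : Type*} [Field F] [Fintype F] (m : ℕ) :
    (Nat.card (GL (Fin m) F) : ℚ) = glOrder (Fintype.card F) m := by
  rw [card_GL_field, glOrder, Finset.prod_range, Nat.cast_prod]
  refine Finset.prod_congr rfl fun i _ => ?_
  rw [Nat.cast_sub (Nat.pow_le_pow_right Fintype.card_pos i.2.le)]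
  simp

theorem coeffA_odd (k q : ℕ) :
    coeffA (2 * k + 1) q = (q : ℚ) ^ (5 * k ^ 2 + 5 * k + 1) *
      (((q : ℚ) ^ (2 * k + 1) - 1) / (q - 1)) *
        ∏ j ∈ Finset.Icc 1 k, ((q : ℚ) ^ (2 * j - 1) - 1) := by
  have h1 : (5 * (2 * k + 1) ^ 2 - 1) / 4 = 5 * k ^ 2 + 5 * k + 1 := by
    rw [show 5 * (2 * k + 1) ^ 2 = 4 * (5 * k ^ 2 + 5 * k + 1) + 1 by ring, Nat.add_sub_cancel,
      Nat.mul_div_cancel_left _ (by norm_num)]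
  have h2 : (2 * k + 1 - 1) / 2 = k := by omega
  rw [coeffA, h1, h2]
  simp [qBinom]

theorem coeffB_odd (k q : ℕ) :
    coeffB (2 * k + 1) q = (q : ℚ) ^ (k ^ 2) * ((q : ℚ) ^ (2 * k + 1) - 1) *
        ∏ j ∈ Finset.Icc 1 k, ((q : ℚ) ^ (2 * j) - 1) := by
  have h1 : (2 * k + 1 - 1) ^ 2 / 4 = k ^ 2 := by
    rw [Nat.add_sub_cancel, show (2 * k) ^ 2 = 4 * k ^ 2 by ring,
      Nat.mul_div_cancel_left _ (by norm_num)]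
  have h2 : (2 * k + 1 - 1) / 2 = k := by omega
  rw [coeffB, h1, h2]

end Coefficients

section Final

variable {F : Type*} [Field F] [Fintype F]

theorem traceCount_odd [CharP F 2] (k : ℕ) (β : F) :
    (traceCount (2 * k + 1) β : ℚ) = (Fintype.card F : ℚ)⁻¹ * coeffA (2 * k + 1) (Fintype.card F) *
      (coeffB (2 * k + 1) (Fintype.card F) - (Fintype.card F - 1) +
        Fintype.card F * invCount β) := by
  have h1 := congrArg (Nat.cast : ℕ → ℚ) (traceCount_mul (r := 2 * k) β)
  have h2 := congrArg (Nat.cast : ℕ → ℚ) (card_trace_mul_sigma (r := 2 * k) β)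
  set M := Nat.card {p : parabolicSubgroup F (2 * k + 1) //
        trace ((((p : orthogonalGroup F (2 * k + 1)) * sigma F (2 * k + 1) (2 * k) :
          orthogonalGroup F (2 * k + 1)) :
          GL (Idx (2 * k + 1)) F) : Matrix (Idx (2 * k + 1)) (Idx (2 * k + 1)) F) = β}
  have hs : Nat.choose (2 * k + 2) 2 = 2 * k ^ 2 + 3 * k + 1 := by
    rw [Nat.choose_two_right, show (2 * k + 2) * (2 * k + 2 - 1) = 2 * (2 * k ^ 2 + 3 * k + 1) by
      rw [Nat.add_sub_assoc (by norm_num)]; ring, Nat.mul_div_cancel_left _ (by norm_num)]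
  have hq1 : 1 ≤ Fintype.card F := Fintype.card_pos
  rw [hs] at h1 h2
  push_cast [hq1, card_GL_eq_glOrder] at h1 h2
  rw [glOrder_succ, altCount_fin] at h2
  rw [glOrder_succ] at h1
  have hgl : glOrder (Fintype.card F) (2 * k) ≠ 0 := by
    rw [← card_GL_eq_glOrder, Nat.cast_ne_zero]
    exact Nat.card_pos.ne'
  rw [glOrder_two_mul] at h2
  rw [coeffA_odd, coeffB_odd]
  have hq : (1 : ℚ) < Fintype.card F := by exact_mod_cast Fintype.one_lt_card (α := F)
  generalize (Fintype.card F : ℚ) = q at *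
  generalize glOrder q (2 * k) = g at *
  generalize ∏ j ∈ Finset.Icc 1 k, (q ^ (2 * j - 1) - 1) = p₁ at *
  generalize ∏ j ∈ Finset.Icc 1 k, (q ^ (2 * j) - 1) = p₂ at *
  have hq0 : q ≠ 0 := by positivity
  have hq2 : q - 1 ≠ 0 := sub_ne_zero.2 hq.ne'
  have he : q ^ (2 * k ^ 2 + 3 * k + 1) * q ^ (2 * k ^ 2 + 3 * k + 1) * q ^ (k * (k - 1)) *
      q ^ (2 * k) = q ^ (5 * k ^ 2 + 5 * k + 1) * q ^ (2 * k + 1) := by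
    simp only [← pow_add]
    congr 1
    rcases k with _ | k
    · rfl
    · simp only [Nat.add_sub_cancel]; ring
  have ha : q ^ (2 * k) ≠ 0 := pow_ne_zero _ hq0
  have hb : q ^ (2 * k + 1) ≠ 0 := pow_ne_zero _ hq0
  generalize q ^ (2 * k ^ 2 + 3 * k + 1) = S at *
  generalize q ^ (k * (k - 1)) = u at *
  generalize q ^ (5 * k ^ 2 + 5 * k + 1) = E at *
  generalize q ^ (2 * k) = a at *
  generalize q ^ (2 * k + 1) = b at *
  generalize q ^ k ^ 2 = w at *
  have key : (traceCount (2 * k + 1) β : ℚ) * (q * (q - 1)) =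
      E * (b - 1) * p₁ * (w * (b - 1) * p₂ - (q - 1) + q * invCount β) := by
    refine mul_left_cancel₀ (mul_ne_zero (mul_ne_zero hgl ha) hb) ?_
    linear_combination q * h1 + (b - 1) * a * g * S * h2 +
      g * a * (b - 1) * p₁ * (w * (b - 1) * p₂ - (q - 1) + q * invCount β) * he
  field_simp
  linear_combination key

end Final

end OrthDoubleCoset

theorem mainTheorem5 {F : Type*} [Field F] [Fintype F] (q r : ℕ) (hq : q = 2 ^ r)
    (hF : Fintype.card F = q) (n : ℕ) (hn : Odd n) (β : F) :
    (β = 1 →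
      (OrthDoubleCoset.traceCount n β : ℚ) =
        (q : ℚ)⁻¹ * OrthDoubleCoset.coeffA n q * OrthDoubleCoset.coeffB n q +
          (q : ℚ)⁻¹ * OrthDoubleCoset.coeffA n q * 1) ∧
    (β ≠ 1 → OrthDoubleCoset.absTrace r ((β - 1)⁻¹) = 0 →
      (OrthDoubleCoset.traceCount n β : ℚ) =
        (q : ℚ)⁻¹ * OrthDoubleCoset.coeffA n q * OrthDoubleCoset.coeffB n q +
          (q : ℚ)⁻¹ * OrthDoubleCoset.coeffA n q * ((q : ℚ) + 1)) ∧
    (β ≠ 1 → OrthDoubleCoset.absTrace r ((β - 1)⁻¹) = 1 →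
      (OrthDoubleCoset.traceCount n β : ℚ) =
        (q : ℚ)⁻¹ * OrthDoubleCoset.coeffA n q * OrthDoubleCoset.coeffB n q +
          (q : ℚ)⁻¹ * OrthDoubleCoset.coeffA n q * (-(q : ℚ) + 1)) := by
  have hcard : Fintype.card F = 2 ^ r := hF.trans hq
  have : CharP F 2 := charP_of_card_eq_prime_pow hcard
  obtain ⟨k, rfl⟩ := hn
  have h := OrthDoubleCoset.traceCount_odd k β
  rw [hF] at h
  refine ⟨?_, fun hβ h0 => ?_, fun hβ h1 => ?_⟩
  · rintro rfl
    rw [h, OrthDoubleCoset.invCount_one]; push_cast; ring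
  · rw [h, (OrthDoubleCoset.invCount_of_absTrace hcard hβ).1 h0]; push_cast; ring
  · rw [h, (OrthDoubleCoset.invCount_of_absTrace hcard hβ).2 h1]; push_cast; ring
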